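/- Let $k\ge 0$ be an integer. A virtual $k$-string tangle is a virtual tangle diagram in a disk (a generic immersion of $k$ arcs, called strings, with their $2k$ endpoints on the boundary circle, together with finitely many closed curves, called loops, in which each double point is either a classical crossing with over/under information or a virtual crossing without it). An arc of the diagram is a maximal piece of a curve that does not pass under a classical crossing (arcs continue through virtual crossings). A $\mathbb{Z}$-coloring of the diagram is a map from its set of arcs to $\mathbb{Z}$ such that $a+c=2b$ holds at each classical crossing, where $a,c$ are the colors of the two under-arcs and $b$ is the color of the over-arc. The endpoints of the diagram are numbered $1,\dots,2k$ in cyclic order along the boundary circle; they receive $v=(a_1,\dots,a_{2k})$ if the arc at the $i$th endpoint has color $a_i$ for each $i$. For $v=(a_1,\dots,a_{2k})\in\mathbb{Z}^{2k}$ put $$\Delta(v)=\sum_{i=1}^{2k}(-1)^{i-1}a_i,\qquad d(v)=\gcd\{a_i-a_j \mid 1\le i,j\le 2k\}\ge 0,$$ and let $d_2(v)$ be the largest power of $2$ dividing $d(v)$ if $d(v)>0$, and $d_2(v)=0$ if $d(v)=0$. Congruence modulo $0$ means equality. Then for every $v\in\mathbb{Z}^{2k}$: 1. There is a virtual $k$-string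 tangle without loops admitting a $\mathbb{Z}$-coloring such that its $2k$ endpoints receive $v$ if and only if $\Delta(v)\equiv 0 \pmod{2d_2(v)}$. 2. There is a virtual $k$-string tangle, possibly with some loops, admitting a $\mathbb{Z}$-coloring such that its $2k$ endpoints receive $v$ if and only if $\Delta(v)\equiv 0\pmod 2$. -/

import Mathlib

/-! Virtual tangle diagrams are drawn in a horizontal strip and cut by horizontal lines ("levels")
into elementary slices, each containing exactly one classical crossing, virtual crossing, local
minimum or local maximum. Every tangle diagram is of this form up to planar isotopy. At each level
the diagram meets the horizontal line in finitely many points, numbered from left to right. -/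

namespace VirtualTangle

/-- The kinds of crossing of a strand `\` (upper left to lower right) and a strand `/`
(upper right to lower left). -/
inductive CrossingKind : Type
  /-- classical crossing, the strand `\` passes over -/
  | leftOver
  /-- classical crossing, the strand `/` passes over -/
  | rightOver
  /-- virtual crossing, with no over/under information -/
  | virt

/-- `Slice m n`: an elementary slice with `m` points on its upper line and `n` on its lower line.
The singular event happens at the adjacent positions `i.castSucc` and `i.succ`. -/
inductive Slice : ℕ → ℕ → Type
  /-- a crossing of two adjacent strands -/
  | crossing {n : ℕ} (κ : CrossingKind) (i : Fin (n + 1)) : Slice (n + 2) (n + 2)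
  /-- a local minimum: two adjacent strands coming from above are joined -/
  | cup {n : ℕ} (i : Fin (n + 1)) : Slice (n + 2) n
  /-- a local maximum: two adjacent strands are created -/
  | cap {n : ℕ} (i : Fin (n + 1)) : Slice n (n + 2)

/-- The order embedding of `n` positions into `n + 2` positions that leaves out the adjacent
positions `i.castSucc` and `i.succ`. -/
def skipTwo {n : ℕ} (i : Fin (n + 1)) (j : Fin n) : Fin (n + 2) :=
  if j.val < i.val then j.castSucc.castSucc else j.succ.succ

/-- The points on the two boundary lines of a slice: `inl` for the upper, `inr` for the lower. -/
abbrev Slice.Point (m n : ℕ) : Type := Fin m ⊕ Fin n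

/-- Two boundary points of a slice are the ends of a segment that does not pass under a classical
crossing in this slice (an over-strand, a strand of a virtual crossing, the curve of a local
minimum or maximum, or a vertical strand). -/
inductive Slice.SameArc : {m n : ℕ} → Slice m n → Slice.Point m n → Slice.Point m n → Prop
  | crossing_vertical {n : ℕ} (κ : CrossingKind) (i : Fin (n + 1)) (j : Fin (n + 2))
      (h₁ : j ≠ i.castSucc) (h₂ : j ≠ i.succ) :
      Slice.SameArc (.crossing κ i) (.inl j) (.inr j)
  | leftOver_over {n : ℕ} (i : Fin (n + 1)) :
      Slice.SameArc (.crossing .leftOver i) (.inl i.castSucc) (.inr i.succ)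
  | rightOver_over {n : ℕ} (i : Fin (n + 1)) :
      Slice.SameArc (.crossing .rightOver i) (.inl i.succ) (.inr i.castSucc)
  | virt_left {n : ℕ} (i : Fin (n + 1)) :
      Slice.SameArc (.crossing .virt i) (.inl i.castSucc) (.inr i.succ)
  | virt_right {n : ℕ} (i : Fin (n + 1)) :
      Slice.SameArc (.crossing .virt i) (.inl i.succ) (.inr i.castSucc)
  | cup_vertical {n : ℕ} (i : Fin (n + 1)) (j : Fin n) :
      Slice.SameArc (.cup i) (.inl (skipTwo i j)) (.inr j)
  | cup_turn {n : ℕ} (i : Fin (n + 1)) :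
      Slice.SameArc (.cup i) (.inl i.castSucc) (.inl i.succ)
  | cap_vertical {n : ℕ} (i : Fin (n + 1)) (j : Fin n) :
      Slice.SameArc (.cap i) (.inl j) (.inr (skipTwo i j))
  | cap_turn {n : ℕ} (i : Fin (n + 1)) :
      Slice.SameArc (.cap i) (.inr i.castSucc) (.inr i.succ)

/-- `s.Under a c b`: the slice `s` is a classical crossing at which the under-strand runs from `a`
to `c` and `b` lies on the over-strand. -/
inductive Slice.Under : {m n : ℕ} → Slice m n →
    Slice.Point m n → Slice.Point m n → Slice.Point m n → Prop
  | leftOver {n : ℕ} (i : Fin (n + 1)) :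
      Slice.Under (.crossing .leftOver i) (.inl i.succ) (.inr i.castSucc) (.inl i.castSucc)
  | rightOver {n : ℕ} (i : Fin (n + 1)) :
      Slice.Under (.crossing .rightOver i) (.inl i.castSucc) (.inr i.succ) (.inl i.succ)

/-- Virtual tangle diagrams with `p` endpoints at the top and `q` endpoints at the bottom:
slices stacked from top to bottom. -/
inductive Diagram : ℕ → ℕ → Type
  | nil (n : ℕ) : Diagram n n
  | cons {p n q : ℕ} (s : Slice p n) (D : Diagram n q) : Diagram p q

namespace Diagram

/-- The points in which the diagram meets the levels. -/
def Point : {p q : ℕ} → Diagram p q → Type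
  | _, _, .nil n => Fin n
  | p, _, .cons _ D => Fin p ⊕ D.Point

/-- The endpoints at the top, from left to right. -/
def top : {p q : ℕ} → (D : Diagram p q) → Fin p → D.Point
  | _, _, .nil _ => fun i => i
  | _, _, .cons _ _ => fun i => Sum.inl i

/-- The endpoints at the bottom, from left to right. -/
def bottom : {p q : ℕ} → (D : Diagram p q) → Fin q → D.Point
  | _, _, .nil _ => fun i => i
  | _, _, .cons _ D => fun i => Sum.inr (D.bottom i)

/-- The boundary points of the first slice, as points of the diagram. -/
def ofSlice {p n q : ℕ} (s : Slice p n) (D : Diagram n q) : Slice.Point p n → (cons s D).Point :=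
  Sum.map id D.top

/-- Two points are joined by a segment inside one slice that does not pass under a classical
crossing. -/
inductive SameArc : {p q : ℕ} → (D : Diagram p q) → D.Point → D.Point → Prop
  | head {p n q : ℕ} {s : Slice p n} (D : Diagram n q) {a b : Slice.Point p n} :
      s.SameArc a b → SameArc (cons s D) (ofSlice s D a) (ofSlice s D b)
  | tail {p n q : ℕ} (s : Slice p n) {D : Diagram n q} {a b : D.Point} :
      SameArc D a b → SameArc (cons s D) (Sum.inr a) (Sum.inr b)

/-- `D.Under a c b`: at some classical crossing of `D` the under-strand runs from `a` to `c`,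
and `b` lies on the over-strand. -/
inductive Under : {p q : ℕ} → (D : Diagram p q) → D.Point → D.Point → D.Point → Prop
  | head {p n q : ℕ} {s : Slice p n} (D : Diagram n q) {a c b : Slice.Point p n} :
      s.Under a c b → Under (cons s D) (ofSlice s D a) (ofSlice s D c) (ofSlice s D b)
  | tail {p n q : ℕ} (s : Slice p n) {D : Diagram n q} {a c b : D.Point} :
      Under D a c b → Under (cons s D) (Sum.inr a) (Sum.inr c) (Sum.inr b)

/-- The arcs of a diagram: maximal pieces of the curves that do not pass under a classical
crossing. -/
def Arc {p q : ℕ} (D : Diagram p q) : Type := Quot D.SameArc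

/-- The arc on which a point lies. -/
def arc {p q : ℕ} (D : Diagram p q) (x : D.Point) : D.Arc := Quot.mk _ x

/-- Fox `ℤ`-colorings: `a + c = 2 b` at each classical crossing with under-arcs colored `a`, `c`
and over-arc colored `b`. -/
def IsColoring {p q : ℕ} (D : Diagram p q) (C : D.Arc → ℤ) : Prop :=
  ∀ a c b : D.Point, D.Under a c b → C (D.arc a) + C (D.arc c) = 2 * C (D.arc b)

/-- Two points are joined by a segment of the diagram inside one slice. -/
def Joined {p q : ℕ} (D : Diagram p q) (x y : D.Point) : Prop :=
  D.SameArc x y ∨ ∃ b, D.Under x y b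

/-- Two points lie on the same component (string or loop) of the diagram. -/
def SameComponent {p q : ℕ} (D : Diagram p q) : D.Point → D.Point → Prop :=
  Relation.EqvGen D.Joined

/-- A diagram has no loops if every component has an endpoint. -/
def WithoutLoops {p q : ℕ} (D : Diagram p q) : Prop :=
  ∀ x : D.Point, (∃ i, D.SameComponent x (D.top i)) ∨ (∃ i, D.SameComponent x (D.bottom i))

end Diagram

/-- Virtual `k`-string tangles possibly with some loops. The `2k` endpoints are placed in their
cyclic order from left to right on the top line; they are joined in pairs by the `k` strings, and
every other component is a loop. -/
abbrev StringTangle (k : ℕ) : Type := Diagram (2 * k) 0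

/-- `T` admits a `ℤ`-coloring such that its endpoints receive `v`. -/
def StringTangle.EndpointsReceive {k : ℕ} (T : StringTangle k) (v : Fin (2 * k) → ℤ) : Prop :=
  ∃ C : T.Arc → ℤ, T.IsColoring C ∧ ∀ i, C (T.arc (T.top i)) = v i

/-- The alternating sum `a₁ - a₂ + a₃ - ⋯`. -/
def alternatingSum {m : ℕ} (v : Fin m → ℤ) : ℤ := ∑ i : Fin m, (-1) ^ (i : ℕ) * v i

/-- The greatest common divisor of the differences `aᵢ - aⱼ`. -/
def diffGcd {m : ℕ} (v : Fin m → ℤ) : ℕ :=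
  (Finset.univ : Finset (Fin m × Fin m)).gcd fun p => (v p.1 - v p.2).natAbs

/-- The largest power of two dividing `diffGcd v`, and `0` if `diffGcd v = 0`. -/
def diffGcdTwo {m : ℕ} (v : Fin m → ℤ) : ℕ :=
  if diffGcd v = 0 then 0 else 2 ^ padicValNat 2 (diffGcd v)

end VirtualTangle

namespace VirtualTangle

/-! Necessity: modulo 2 an under-strand keeps its color and turns add equal pairs, so the sum of
colors on a level is constant and ends at 0. Without loops, endpoint colors congruent to `a` mod `2
^ s` force all colors to be so; then `(f - a) / 2 ^ s` is again a coloring with even endpoint sum.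
This sum is comparable with Δ by `two_mul_dvd_alternatingSum_sub`.

Sufficiency: virtual crossings permute the endpoints freely, so a classical crossing replaces any `u
j` by `2 * u i - u j`. Such reflections shrink the range of colors until at most two values remain
(`closes_of_dvd_sum_sub`); the divisibility hypothesis, invariant under reflection, makes both
multiplicities even, and equal colors are joined in pairs. With loops one may reflect in any
integer, which reduces all colors to 0 and 1 (`closes_of_two_dvd_sum`). -/

/-- The colors `u` on the upper and `w` on the lower line of a slice extend to a coloring of it. -/
def Slice.Compatible {m n : ℕ} (s : Slice m n) (u : Fin m → ℤ) (w : Fin n → ℤ) : Prop :=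
  (∀ a b, s.SameArc a b → Sum.elim u w a = Sum.elim u w b) ∧
  ∀ a c b, s.Under a c b → Sum.elim u w a + Sum.elim u w c = 2 * Sum.elim u w b

/-! ### Colorings as functions on points, and their parity -/

namespace Diagram

/-- Colorings of a diagram, as functions on its points. -/
def IsPointColoring {p q : ℕ} (D : Diagram p q) (f : D.Point → ℤ) : Prop :=
  (∀ a b, D.SameArc a b → f a = f b) ∧ ∀ a c b, D.Under a c b → f a + f c = 2 * f b

theorem IsColoring.isPointColoring {p q : ℕ} {D : Diagram p q} {C : D.Arc → ℤ}
    (hC : D.IsColoring C) : D.IsPointColoring fun x => C (D.arc x) :=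
  ⟨fun _ _ h => congrArg C (Quot.sound h), hC⟩

theorem endpointsReceive_of_isPointColoring {k : ℕ} {T : StringTangle k} {v : Fin (2 * k) → ℤ}
    {f : Point T → ℤ} (hf : IsPointColoring T f) (hv : ∀ i, f (top T i) = v i) :
    T.EndpointsReceive v :=
  ⟨Quot.lift f hf.1, hf.2, hv⟩

theorem elim_comp_ofSlice {p n q : ℕ} (s : Slice p n) (D : Diagram n q) (f : (cons s D).Point → ℤ)
    (a : Slice.Point p n) :
    Sum.elim (fun i => f (Sum.inl i)) (fun i => f (Sum.inr (D.top i))) a = f (ofSlice s D a) := by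
  cases a <;> rfl

theorem isPointColoring_cons {p n q : ℕ} {s : Slice p n} {D : Diagram n q}
    {f : (cons s D).Point → ℤ} :
    (cons s D).IsPointColoring f ↔
      s.Compatible (fun i => f (Sum.inl i)) (fun i => f (Sum.inr (D.top i))) ∧
        D.IsPointColoring fun x => f (Sum.inr x) := by
  constructor
  · rintro ⟨h₁, h₂⟩
    refine ⟨⟨fun a b h => ?_, fun a c b h => ?_⟩, fun a b h => h₁ _ _ (.tail s h),
      fun a c b h => h₂ _ _ _ (.tail s h)⟩
    · simpa only [elim_comp_ofSlice] using h₁ _ _ (.head D h)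
    · simpa only [elim_comp_ofSlice] using h₂ _ _ _ (.head D h)
  · rintro ⟨⟨h₁, h₂⟩, h₃, h₄⟩
    constructor
    · intro a b h
      cases h with
      | head _ h => simpa only [elim_comp_ofSlice] using h₁ _ _ h
      | tail _ h => exact h₃ _ _ h
    · intro a c b h
      cases h with
      | head _ h => simpa only [elim_comp_ofSlice] using h₂ _ _ _ h
      | tail _ h => exact h₄ _ _ _ h

/-- The coloring equations are affine invariant; this permits division by powers of two. -/
theorem IsPointColoring.of_mul_add {p q : ℕ} {D : Diagram p q} {f g : D.Point → ℤ} {e a : ℤ}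
    (hf : D.IsPointColoring f) (he : e ≠ 0) (h : ∀ x, f x = e * g x + a) :
    D.IsPointColoring g := by
  refine ⟨fun x y hxy => ?_, fun x z y hxy => ?_⟩
  · have := hf.1 x y hxy
    rw [h, h] at this
    exact mul_left_cancel₀ he (by linarith)
  · have := hf.2 x z y hxy
    rw [h, h, h] at this
    exact mul_left_cancel₀ he (by linarith)

theorem IsPointColoring.modEq_two {p q : ℕ} {D : Diagram p q} {f : D.Point → ℤ}
    (hf : D.IsPointColoring f) {x y : D.Point} (h : D.SameComponent x y) :
    f x ≡ f y [ZMOD 2] := by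
  induction h with
  | rel x y h =>
    rcases h with h | ⟨b, h⟩
    · rw [hf.1 x y h]
    · have := hf.2 x y b h
      simp only [Int.ModEq]; omega
  | refl => rfl
  | symm _ _ _ ih => exact ih.symm
  | trans _ _ _ _ _ ih₁ ih₂ => exact ih₁.trans ih₂

end Diagram

theorem skipTwo_eq_succAbove {n : ℕ} (i : Fin (n + 1)) (j : Fin n) :
    skipTwo i j = i.castSucc.succAbove (i.succAbove j) := by
  unfold skipTwo Fin.succAbove
  ext
  simp only [Fin.lt_def, Fin.val_castSucc]
  split_ifs <;> simp_all; omega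

theorem sum_eq_add_add_sum_skipTwo {n : ℕ} (i : Fin (n + 1)) (u : Fin (n + 2) → ℤ) :
    ∑ j, u j = u i.castSucc + u i.succ + ∑ j, u (skipTwo i j) := by
  rw [Fin.sum_univ_succAbove _ i.castSucc, Fin.sum_univ_succAbove _ i, ← add_assoc,
    Fin.succAbove_castSucc_self]
  simp only [skipTwo_eq_succAbove]

theorem Slice.Compatible.sum_modEq_two {m n : ℕ} {s : Slice m n} {u : Fin m → ℤ} {w : Fin n → ℤ}
    (h : s.Compatible u w) : ∑ i, u i ≡ ∑ i, w i [ZMOD 2] := by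
  obtain ⟨h₁, h₂⟩ := h
  cases s with
  | @crossing n κ i =>
    have h₃ : ∀ j, u (skipTwo i j) = w (skipTwo i j) := fun j =>
      h₁ _ _ (.crossing_vertical κ i (skipTwo i j)
        (by rw [skipTwo_eq_succAbove]; exact Fin.succAbove_ne _ _)
        (by
          rw [skipTwo_eq_succAbove, ← Fin.succAbove_castSucc_self i]
          exact fun h => Fin.succAbove_ne _ _ (Fin.succAbove_right_injective h)))
    rw [sum_eq_add_add_sum_skipTwo i u, sum_eq_add_add_sum_skipTwo i w]
    simp only [h₃]
    refine Int.ModEq.add_right _ ?_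
    simp only [Int.ModEq]
    cases κ with
    | leftOver =>
      have := h₁ _ _ (.leftOver_over i)
      have := h₂ _ _ _ (.leftOver i)
      simp only [Sum.elim_inl, Sum.elim_inr] at *
      omega
    | rightOver =>
      have := h₁ _ _ (.rightOver_over i)
      have := h₂ _ _ _ (.rightOver i)
      simp only [Sum.elim_inl, Sum.elim_inr] at *
      omega
    | virt =>
      have := h₁ _ _ (.virt_left i)
      have := h₁ _ _ (.virt_right i)
      simp only [Sum.elim_inl, Sum.elim_inr] at *
      omega
  | cup i =>
    rw [sum_eq_add_add_sum_skipTwo i u]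
    have h₃ : ∀ j, u (skipTwo i j) = w j := fun j => h₁ _ _ (.cup_vertical i j)
    have h₄ : u i.castSucc = u i.succ := h₁ _ _ (.cup_turn i)
    simp only [h₃, h₄, Int.ModEq]
    omega
  | cap i =>
    rw [sum_eq_add_add_sum_skipTwo i w]
    have h₃ : ∀ j, u j = w (skipTwo i j) := fun j => h₁ _ _ (.cap_vertical i j)
    have h₄ : w i.castSucc = w i.succ := h₁ _ _ (.cap_turn i)
    simp only [h₃, h₄, Int.ModEq]
    omega

/-! ### Necessary conditions, and connectivity to the top -/

namespace Diagram

theorem IsPointColoring.sum_modEq_two {p q : ℕ} {D : Diagram p q} {f : D.Point → ℤ}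
    (hf : D.IsPointColoring f) : ∑ i, f (D.top i) ≡ ∑ i, f (D.bottom i) [ZMOD 2] := by
  induction D with
  | nil n => rfl
  | cons s D ih =>
    rw [isPointColoring_cons] at hf
    exact hf.1.sum_modEq_two.trans (ih hf.2)

/-- In a diagram without loops the colors are congruent modulo every power of two modulo which
the colors of the endpoints are. -/
theorem IsPointColoring.two_pow_dvd {p : ℕ} {D : Diagram p 0} {f : D.Point → ℤ}
    (hf : D.IsPointColoring f) (hD : D.WithoutLoops) {a : ℤ} (s : ℕ)
    (h : ∀ i, 2 ^ s ∣ f (D.top i) - a) (x : D.Point) : 2 ^ s ∣ f x - a := by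
  induction s generalizing x with
  | zero => simp
  | succ s ih =>
    -- The quotient `g = (f - a) / 2 ^ s` is a coloring that is even at the endpoints; parity is
    -- constant on components, and each of them has an endpoint.
    choose g hg using ih fun i => (pow_dvd_pow 2 s.le_succ).trans (h i)
    have hgc : D.IsPointColoring g :=
      hf.of_mul_add (e := 2 ^ s) (a := a) (by positivity) fun x => by rw [← hg]; ring
    obtain ⟨i, hi⟩ := (hD x).resolve_right fun ⟨i, _⟩ => i.elim0
    have hi' : (2 : ℤ) ∣ g (D.top i) := by
      have := h i
      rw [hg, pow_succ] at this
      exact Int.dvd_of_mul_dvd_mul_left (by positivity) this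
    rw [hg, pow_succ]
    exact mul_dvd_mul_left _ ((hgc.modEq_two hi).dvd_iff.2 hi')

theorem IsPointColoring.two_pow_dvd_sum {p : ℕ} {D : Diagram p 0} {f : D.Point → ℤ}
    (hf : D.IsPointColoring f) (hD : D.WithoutLoops) {a : ℤ} (s : ℕ)
    (h : ∀ i, 2 ^ s ∣ f (D.top i) - a) : 2 * 2 ^ s ∣ ∑ i, (f (D.top i) - a) := by
  choose g hg using hf.two_pow_dvd hD s h
  have hgc : D.IsPointColoring g :=
    hf.of_mul_add (e := 2 ^ s) (a := a) (by positivity) fun x => by rw [← hg]; ring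
  have := hgc.sum_modEq_two
  simp only [hg, ← Finset.mul_sum, Finset.univ_eq_empty, Finset.sum_empty] at this ⊢
  rw [mul_comm]
  exact mul_dvd_mul_left _ (Int.modEq_zero_iff_dvd.1 this)

/-- Every component has an endpoint at the top. -/
def TopConnected {p q : ℕ} (D : Diagram p q) : Prop := ∀ x, ∃ i, D.SameComponent x (D.top i)

theorem SameComponent.tail {p n q : ℕ} (s : Slice p n) {D : Diagram n q} {x y : D.Point}
    (h : D.SameComponent x y) : (cons s D).SameComponent (Sum.inr x) (Sum.inr y) := by
  induction h with
  | rel x y h =>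
    refine .rel _ _ ?_
    rcases h with h | ⟨b, h⟩
    · exact .inl (.tail s h)
    · exact .inr ⟨_, .tail s h⟩
  | refl => exact .refl _
  | symm _ _ _ ih => exact ih.symm
  | trans _ _ _ _ _ ih₁ ih₂ => exact ih₁.trans _ _ _ ih₂

/-- The condition on `s` holds for crossings and cups but fails for caps, the only source of loops
here. -/
theorem TopConnected.cons {p n q : ℕ} {s : Slice p n} {D : Diagram n q} (hD : D.TopConnected)
    (hs : ∀ j, ∃ i, s.SameArc (.inl i) (.inr j) ∨ ∃ b, s.Under (.inl i) (.inr j) b) :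
    (cons s D).TopConnected := by
  rintro (x | x)
  · exact ⟨x, .refl _⟩
  · obtain ⟨j, hj⟩ := hD x
    obtain ⟨i, hi⟩ := hs j
    refine ⟨i, (hj.tail s).trans _ _ _ (.symm _ _ (.rel _ _ ?_))⟩
    rcases hi with h | ⟨b, h⟩
    · exact .inl (.head D h)
    · exact .inr ⟨_, .head D h⟩

end Diagram

/-! ### Moves on endpoint colors -/

/-- Some tangle diagram, without loops unless `L` holds, has a coloring that gives its endpoints
the colors `u`. -/
def Closes (L : Prop) {m : ℕ} (u : Fin m → ℤ) : Prop :=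
  ∃ D : Diagram m 0, (L ∨ D.TopConnected) ∧
    ∃ f, D.IsPointColoring f ∧ ∀ i, f (D.top i) = u i

theorem closes_zero (L : Prop) (u : Fin 0 → ℤ) : Closes L u :=
  ⟨.nil 0, .inr fun x => Fin.elim0 x, fun _ => 0,
    ⟨fun _ _ _ => rfl, fun _ _ _ _ => rfl⟩, fun i => i.elim0⟩

theorem Closes.of_slice {L : Prop} {m n : ℕ} {u : Fin m → ℤ} {w : Fin n → ℤ} (h : Closes L w)
    (s : Slice m n) (hs : s.Compatible u w)
    (hL : L ∨ ∀ j, ∃ i, s.SameArc (.inl i) (.inr j) ∨ ∃ b, s.Under (.inl i) (.inr j) b) :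
    Closes L u := by
  obtain ⟨D, hD, f, hf, hw⟩ := h
  refine ⟨.cons s D, ?_, Sum.elim u f, ?_, fun i => rfl⟩
  · rcases hL with hL | hL
    · exact .inl hL
    · exact hD.imp_right fun h => h.cons hL
  · refine Diagram.isPointColoring_cons.2 ⟨?_, hf⟩
    have hw' : (fun i => f (D.top i)) = w := funext hw
    rwa [← hw'] at hs

theorem Closes.of_virt {L : Prop} {n : ℕ} {u : Fin (n + 2) → ℤ} (i : Fin (n + 1))
    (h : Closes L (u ∘ Equiv.swap i.castSucc i.succ)) : Closes L u := by
  refine h.of_slice (.crossing .virt i) ⟨?_, ?_⟩ (.inr fun j => ?_)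
  · intro a b h
    cases h with
    | crossing_vertical _ _ j h₁ h₂ => simp [Equiv.swap_apply_of_ne_of_ne h₁ h₂]
    | virt_left => simp
    | virt_right => simp
  · intro a c b h
    cases h
  · by_cases h₁ : j = i.castSucc
    · exact ⟨i.succ, .inl (h₁ ▸ .virt_right i)⟩
    by_cases h₂ : j = i.succ
    · exact ⟨i.castSucc, .inl (h₂ ▸ .virt_left i)⟩
    exact ⟨j, .inl (.crossing_vertical _ i j h₁ h₂)⟩

theorem Closes.of_leftOver {L : Prop} {n : ℕ} {u : Fin (n + 2) → ℤ} (i : Fin (n + 1))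
    (h : Closes L (Function.update u i.succ (2 * u i.castSucc - u i.succ) ∘
      Equiv.swap i.castSucc i.succ)) : Closes L u := by
  have hne : i.castSucc ≠ i.succ := i.castSucc_lt_succ.ne
  refine h.of_slice (.crossing .leftOver i) ⟨?_, ?_⟩ (.inr fun j => ?_)
  · intro a b h
    cases h with
    | crossing_vertical _ _ j h₁ h₂ => simp [Equiv.swap_apply_of_ne_of_ne h₁ h₂, h₂]
    | leftOver_over => simp [hne]
  · intro a c b h
    cases h
    simp
  · by_cases h₁ : j = i.castSucc
    · exact ⟨i.succ, .inr ⟨_, h₁ ▸ Slice.Under.leftOver i⟩⟩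
    by_cases h₂ : j = i.succ
    · exact ⟨i.castSucc, .inl (h₂ ▸ .leftOver_over i)⟩
    exact ⟨j, .inl (.crossing_vertical _ i j h₁ h₂)⟩

theorem Closes.of_cup {L : Prop} {n : ℕ} {u : Fin (n + 2) → ℤ} (h₀ : u 0 = u 1)
    (h : Closes L fun j : Fin n => u j.succ.succ) : Closes L u := by
  refine h.of_slice (.cup 0) ⟨?_, ?_⟩ (.inr fun j => ⟨_, .inl (.cup_vertical 0 j)⟩)
  · intro a b h
    cases h with
    | cup_vertical _ j => simp [skipTwo]
    | cup_turn => simpa using h₀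
  · intro a c b h
    cases h

theorem Closes.of_cap {L : Prop} (hL : L) {n : ℕ} {u : Fin n → ℤ} (c : ℤ)
    (h : Closes L (Fin.cons c (Fin.cons c u : Fin (n + 1) → ℤ) : Fin (n + 2) → ℤ)) :
    Closes L u := by
  refine h.of_slice (.cap 0) ⟨?_, ?_⟩ (.inl hL)
  · intro a b h
    cases h with
    | cap_vertical _ j => simp [skipTwo]
    | cap_turn => simp
  · intro a c b h
    cases h

/-- Adjacent transpositions generate the symmetric group. -/
theorem Closes.of_perm {L : Prop} {m : ℕ} (σ : Equiv.Perm (Fin m)) {u : Fin m → ℤ}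
    (h : Closes L (u ∘ σ)) : Closes L u := by
  obtain _ | _ | n := m
  · rwa [Subsingleton.elim (u ∘ σ) u] at h
  · rwa [show σ = 1 from Equiv.ext fun _ => Fin.ext (by omega)] at h
  · have hσ : σ ∈ Submonoid.closure
        (Set.range fun i : Fin (n + 1) => Equiv.swap i.castSucc i.succ) := by
      rw [Equiv.Perm.mclosure_swap_castSucc_succ]; trivial
    induction hσ using Submonoid.closure_induction generalizing u with
    | mem σ hσ =>
      obtain ⟨i, rfl⟩ := hσ
      exact h.of_virt i
    | one => exact h
    | mul σ τ _ _ ih₁ ih₂ => exact ih₁ (ih₂ h)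

theorem exists_perm_zero_one {n : ℕ} {i j : Fin (n + 2)} (h : i ≠ j) :
    ∃ σ : Equiv.Perm (Fin (n + 2)), σ 0 = i ∧ σ 1 = j := by
  refine ⟨Equiv.swap (Equiv.swap 0 i 1) j * Equiv.swap 0 i, ?_, ?_⟩
  · rw [Equiv.Perm.mul_apply, Equiv.swap_apply_left]
    refine Equiv.swap_apply_of_ne_of_ne (fun h₁ => ?_) h
    exact zero_ne_one ((Equiv.swap 0 i).injective ((Equiv.swap_apply_left 0 i).trans h₁))
  · rw [Equiv.Perm.mul_apply, Equiv.swap_apply_left]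

theorem Closes.of_reflect {L : Prop} {m : ℕ} {u : Fin m → ℤ} {i j : Fin m} (hij : i ≠ j)
    (h : Closes L (Function.update u j (2 * u i - u j))) : Closes L u := by
  obtain _ | _ | n := m
  · exact i.elim0
  · exact absurd (Fin.ext (by omega)) hij
  · obtain ⟨σ, rfl, rfl⟩ := exists_perm_zero_one hij
    -- Bring strands `i` and `j` to the first two positions, cross them classically, and undo both
    -- permutations virtually.
    refine .of_perm σ (.of_leftOver 0 (.of_perm ((Equiv.swap 0 1).trans σ).symm ?_))
    convert h using 1
    ext x
    obtain ⟨y, rfl⟩ := σ.surjective x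
    simp [Function.update_apply]

theorem Closes.of_reflect_finset {L : Prop} {m : ℕ} {u : Fin m → ℤ} {i : Fin m}
    (S : Finset (Fin m)) (hi : i ∉ S)
    (h : Closes L fun j => if j ∈ S then 2 * u i - u j else u j) : Closes L u := by
  induction S using Finset.induction_on with
  | empty => simpa using h
  | insert a S ha ih =>
    rw [Finset.mem_insert, not_or] at hi
    refine ih hi.2 (.of_reflect (i := i) (j := a) hi.1 ?_)
    convert h using 1
    ext x
    by_cases hx : x = a
    · subst hx; simp [ha, hi.2]
    · simp [hx]

/-- A loop of color `c` is opened by a cap, strand `j` passes under it, and a cup closes it. -/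
theorem Closes.of_reflect_loop {L : Prop} (hL : L) {m : ℕ} {u : Fin m → ℤ} (c : ℤ) (j : Fin m)
    (h : Closes L (Function.update u j (2 * c - u j))) : Closes L u := by
  refine .of_cap hL c (.of_reflect (i := 0) (j := j.succ.succ) (by simp [Fin.ext_iff]) ?_)
  refine .of_cup (by simp [Fin.ext_iff]) ?_
  convert h using 1
  ext x
  simp [Function.update_apply]

/-! ### Sufficient conditions -/

theorem closes_of_even_fibers {L : Prop} {m : ℕ} {u : Fin m → ℤ}
    (h : ∀ c, Even (∑ i, if u i = c then 1 else 0)) : Closes L u := by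
  induction m using Nat.strong_induction_on with
  | _ m ih =>
  obtain _ | m := m
  · exact closes_zero L u
  obtain ⟨j, hj0, hj⟩ : ∃ j, j ≠ 0 ∧ u j = u 0 := by
    -- Otherwise the color `u 0` would occur exactly once.
    by_contra! hne
    have := h (u 0)
    rw [Finset.sum_eq_single 0 (fun j _ hj => if_neg (hne j hj)) (by simp)] at this
    simp at this
  obtain _ | n := m
  · exact absurd (Fin.ext (by omega)) hj0
  obtain ⟨σ, h0, h1⟩ := exists_perm_zero_one hj0.symm
  refine .of_perm σ (.of_cup (by simp [h0, h1, hj]) (ih n (by omega) fun c => ?_))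
  have := h c
  rw [← Equiv.sum_comp σ, Fin.sum_univ_succ, Fin.sum_univ_succ, Fin.succ_zero_eq_one, h0, h1, hj,
    ← add_assoc, Nat.even_add] at this
  exact this.1 (Even.add_self _)

theorem closes_of_two_values {L : Prop} {m : ℕ} (hm : Even m) {u : Fin m → ℤ} {a b : ℤ}
    (hab : a ≠ b) (hu : ∀ i, u i = a ∨ u i = b)
    (hb : Even (∑ i, if u i = b then 1 else 0)) : Closes L u := by
  refine closes_of_even_fibers fun c => ?_
  by_cases hcb : c = b
  · rwa [hcb]
  by_cases hca : c = a
  · have : ∑ i, (if u i = c then 1 else 0) + ∑ i, (if u i = b then 1 else 0) = m := by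
      rw [← Finset.sum_add_distrib, Finset.sum_congr rfl (g := fun _ => 1) fun i _ => ?_]
      · simp
      · rcases hu i with h | h <;> simp [h, hca, hab, hab.symm]
    rw [← this] at hm
    exact (Nat.even_add.1 hm).2 hb
  · rw [Finset.sum_eq_zero fun i _ => if_neg ?_]
    · exact Even.zero
    · rcases hu i with h | h <;> rw [h] <;> exact Ne.symm ‹_›

theorem closes_of_two_dvd_sum {m : ℕ} (hm : Even m) {u : Fin m → ℤ} (h : 2 ∣ ∑ i, u i) :
    Closes True u := by
  have key : ∀ S : Finset (Fin m),
      Closes True (fun j => if j ∈ S then u j % 2 else u j) → Closes True u := by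
    intro S
    induction S using Finset.induction_on with
    | empty => simp
    | insert a S ha ih =>
      -- The loop color is the midpoint of `u a` and its residue mod 2, an integer since the two
      -- have equal parity.
      refine fun h => ih (.of_reflect_loop trivial ((u a + u a % 2) / 2) a ?_)
      convert h using 1
      ext x
      by_cases hx : x = a
      · subst hx
        simp only [ha, Function.update_self, Finset.mem_insert_self, if_true, if_false]
        omega
      · simp [hx]
  refine key Finset.univ ?_
  simp only [Finset.mem_univ, if_true]
  refine closes_of_two_values hm zero_ne_one (fun i => Int.emod_two_eq_zero_or_one _) ?_
  rw [← Int.even_coe_nat, even_iff_two_dvd, ← Int.modEq_zero_iff_dvd] at *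
  refine Int.ModEq.trans ?_ h
  push_cast
  refine Int.ModEq.sum fun i _ => ?_
  simp only [Int.ModEq]
  split_ifs <;> omega

/-- Descent on the width of an interval containing the colors. The hypothesis survives a reflection
because each color changes by `2 * (w i - w j)`, a multiple of `2 * e`. -/
theorem closes_of_dvd_sum_sub {L : Prop} {m : ℕ} (hm : Even m) {u : Fin m → ℤ}
    (h : ∀ e a : ℤ, (∀ i, e ∣ u i - a) → 2 * e ∣ ∑ i, (u i - a)) : Closes L u := by
  have reflect : ∀ {w : Fin m → ℤ} (i : Fin m) (S : Finset (Fin m)),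
      (∀ e a : ℤ, (∀ i, e ∣ w i - a) → 2 * e ∣ ∑ i, (w i - a)) → i ∉ S →
      ∀ e a : ℤ, (∀ j, e ∣ (if j ∈ S then 2 * w i - w j else w j) - a) →
        2 * e ∣ ∑ j, ((if j ∈ S then 2 * w i - w j else w j) - a) := by
    intro w i S hw hi e a hS
    have hia : e ∣ w i - a := by simpa [hi] using hS i
    have hwa : ∀ j, e ∣ w j - a := by
      intro j
      by_cases hj : j ∈ S
      · have := hS j
        rw [if_pos hj] at this
        rw [show w j - a = 2 * (w i - a) - (2 * w i - w j - a) by ring]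
        exact (hia.mul_left 2).sub this
      · simpa [hj] using hS j
    rw [← dvd_sub_left (hw e a hwa), ← Finset.sum_sub_distrib]
    refine Finset.dvd_sum fun j _ => ?_
    split_ifs
    · rw [show 2 * w i - w j - a - (w j - a) = 2 * (w i - a - (w j - a)) by ring]
      exact mul_dvd_mul_left 2 (hia.sub (hwa j))
    · simp
  have key : ∀ (N : ℕ) (w : Fin m → ℤ) (lo : ℤ),
      (∀ e a : ℤ, (∀ i, e ∣ w i - a) → 2 * e ∣ ∑ i, (w i - a)) →
      (∀ i, lo ≤ w i ∧ w i ≤ lo + N) → Closes L w := by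
    intro N
    induction N with
    | zero =>
      intro w lo _ hlo
      have hw : ∀ i, w i = lo := fun i => by have := hlo i; push_cast at this; omega
      -- The value `lo + 1` is a dummy that is never attained.
      refine closes_of_two_values hm (a := lo) (b := lo + 1) (by omega) (fun i => .inl (hw i)) ?_
      simp [hw]
    | succ N ih =>
      intro w lo hw hlo
      push_cast at hlo
      by_cases hmid : ∃ i, lo < w i ∧ w i < lo + (N + 1)
      · obtain ⟨i, h₁, h₂⟩ := hmid
        -- Reflecting the extreme nearer to `w i` keeps its image in the interval and vacates that
        -- extreme.
        by_cases hfar : lo + (N + 1) - w i ≤ w i - lo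
        · have hi : i ∉ Finset.univ.filter fun j => w j = lo + (N + 1) := by simp; omega
          refine .of_reflect_finset _ hi (ih _ lo (reflect i _ hw hi) fun j => ?_)
          have := hlo j
          simp only [Finset.mem_filter, Finset.mem_univ, true_and]
          split_ifs <;> omega
        · have hi : i ∉ Finset.univ.filter fun j => w j = lo := by simp; omega
          refine .of_reflect_finset _ hi (ih _ (lo + 1) (reflect i _ hw hi) fun j => ?_)
          have := hlo j
          simp only [Finset.mem_filter, Finset.mem_univ, true_and]
          split_ifs <;> omega
      · push Not at hmid
        have hval : ∀ i, w i = lo ∨ w i = lo + (N + 1) := fun i => by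
          have := hlo i
          have := hmid i
          omega
        refine closes_of_two_values hm (by omega) hval ?_
        have hsum : ∑ i, (w i - lo) =
            (N + 1) * ((∑ i, if w i = lo + (N + 1) then 1 else 0 : ℕ) : ℤ) := by
          push_cast
          rw [Finset.mul_sum]
          refine Finset.sum_congr rfl fun i _ => ?_
          rcases hval i with h | h
          · rw [if_neg (by omega)]; simp [h]
          · simp [h]
        -- Taking for `e` the gap between the two values makes the multiplicity of the upper one
        -- even.
        have := hw (N + 1) lo fun i => by rcases hval i with h | h <;> simp [h]
        rw [hsum, mul_comm] at this
        rw [← Int.even_coe_nat, even_iff_two_dvd]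
        exact Int.dvd_of_mul_dvd_mul_left (by omega) this
  obtain ⟨lo, hlo⟩ := (Set.finite_range u).bddBelow
  obtain ⟨hi, hhi⟩ := (Set.finite_range u).bddAbove
  refine key (hi - lo).toNat u lo h fun i => ?_
  have h₁ := hlo (Set.mem_range_self i)
  have h₂ := hhi (Set.mem_range_self i)
  omega

/-! ### Arithmetic of Δ and the gcd of differences -/

/-- With an even number of entries the shift by `a` cancels in Δ, and the remaining coefficients
`(-1) ^ i - 1` are even. -/
theorem two_mul_dvd_alternatingSum_sub {k : ℕ} {v : Fin (2 * k) → ℤ} {e a : ℤ}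
    (h : ∀ i, e ∣ v i - a) : 2 * e ∣ alternatingSum v - ∑ i, (v i - a) := by
  have hsign : ∑ i : Fin (2 * k), (-1 : ℤ) ^ (i : ℕ) = 0 := by
    rw [Fin.sum_univ_eq_sum_range fun i => (-1 : ℤ) ^ i, neg_one_geom_sum]
    simp
  have : alternatingSum v - ∑ i, (v i - a) =
      ∑ i : Fin (2 * k), ((-1) ^ (i : ℕ) - 1) * (v i - a) := by
    simp only [alternatingSum, sub_mul, mul_sub, Finset.sum_sub_distrib, ← Finset.sum_mul, hsign]
    simp
    ring
  rw [this]
  refine Finset.dvd_sum fun i _ => mul_dvd_mul ?_ (h i)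
  rcases neg_one_pow_eq_or ℤ (i : ℕ) with h | h <;> rw [h] <;> norm_num

theorem dvd_diffGcd_iff {m : ℕ} {v : Fin m → ℤ} {e : ℤ} :
    e ∣ diffGcd v ↔ ∀ i j, e ∣ v i - v j := by
  rw [← Int.natAbs_dvd, Int.natCast_dvd_natCast, diffGcd, Finset.dvd_gcd_iff]
  simp [Int.natAbs_dvd_natAbs]

/-- Only the 2-part of the gcd `d` matters: `d` always divides Δ, so its odd part does, and this is
coprime to twice the 2-part. -/
theorem two_mul_dvd_alternatingSum {k : ℕ} {v : Fin (2 * k) → ℤ}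
    (h : alternatingSum v ≡ 0 [ZMOD 2 * (diffGcdTwo v : ℤ)]) {e a : ℤ}
    (he : ∀ i, e ∣ v i - a) : 2 * e ∣ alternatingSum v := by
  rw [Int.modEq_zero_iff_dvd] at h
  have he' : ∀ i j, e ∣ v i - v j := fun i j => by
    simpa using (he i).sub (he j)
  have hd : e ∣ diffGcd v := dvd_diffGcd_iff.2 he'
  unfold diffGcdTwo at h
  split_ifs at h with h0
  · rw [Nat.cast_zero, mul_zero, zero_dvd_iff] at h
    simp [h]
  obtain rfl | hk := k.eq_zero_or_pos
  · simp [alternatingSum]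
  have hdv : ∀ i, (diffGcd v : ℤ) ∣ v i - v ⟨0, by omega⟩ := fun i => dvd_diffGcd_iff.1 dvd_rfl _ _
  have hdvd : (diffGcd v : ℤ) ∣ alternatingSum v :=
    (dvd_sub_left (Finset.dvd_sum fun i _ => hdv i)).1
      ((Dvd.intro_left 2 rfl).trans (two_mul_dvd_alternatingSum_sub hdv))
  refine (mul_dvd_mul_left 2 hd).trans ?_
  obtain ⟨o, ho⟩ := pow_padicValNat_dvd (p := 2) (n := diffGcd v)
  have hodd : Nat.Coprime 2 o := by
    refine (Nat.Prime.coprime_iff_not_dvd Nat.prime_two).2 fun ⟨r, hr⟩ => ?_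
    refine pow_succ_padicValNat_not_dvd (p := 2) h0 ⟨r, ?_⟩
    rw [pow_succ, mul_assoc, ← hr, ← ho]
  have hcop : IsCoprime (2 * 2 ^ padicValNat 2 (diffGcd v) : ℤ) (o : ℤ) := by
    rw [← pow_succ']
    exact_mod_cast (Nat.isCoprime_iff_coprime.2 (hodd.pow_left _))
  have hd' : (diffGcd v : ℤ) = 2 ^ padicValNat 2 (diffGcd v) * (o : ℤ) := by exact_mod_cast ho
  rw [hd', ← mul_assoc]
  refine hcop.mul_dvd (by exact_mod_cast h) ((Dvd.intro_left _ hd'.symm).trans hdvd)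

theorem alternatingSum_modEq_of_withoutLoops {k : ℕ} {v : Fin (2 * k) → ℤ} {T : StringTangle k}
    (hT : T.WithoutLoops) (h : T.EndpointsReceive v) :
    alternatingSum v ≡ 0 [ZMOD 2 * (diffGcdTwo v : ℤ)] := by
  obtain ⟨C, hC, hv⟩ := h
  rw [Int.modEq_zero_iff_dvd]
  obtain rfl | hk := k.eq_zero_or_pos
  · simp [alternatingSum]
  have hdv : ∀ i, (diffGcdTwo v : ℤ) ∣ v i - v ⟨0, by omega⟩ := fun i => by
    refine dvd_diffGcd_iff.1 (Int.natCast_dvd_natCast.2 ?_) _ _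
    unfold diffGcdTwo
    split_ifs with h0
    · rw [h0]
    · exact pow_padicValNat_dvd
  refine (dvd_sub_left ?_).1 (two_mul_dvd_alternatingSum_sub hdv)
  by_cases h0 : diffGcd v = 0
  · rw [diffGcdTwo, if_pos h0, Nat.cast_zero] at hdv
    simp [zero_dvd_iff.1 (hdv _)]
  · have hpow : (diffGcdTwo v : ℤ) = 2 ^ padicValNat 2 (diffGcd v) := by simp [diffGcdTwo, h0]
    rw [hpow] at hdv ⊢
    simp only [← hv] at hdv ⊢
    exact hC.isPointColoring.two_pow_dvd_sum hT _ hdv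

theorem Closes.exists_stringTangle {L : Prop} {k : ℕ} {v : Fin (2 * k) → ℤ} (h : Closes L v) :
    ∃ T : StringTangle k, (L ∨ T.WithoutLoops) ∧ T.EndpointsReceive v := by
  obtain ⟨D, hD, f, hf, hv⟩ := h
  exact ⟨D, hD.imp_right fun h x => .inl (h x), Diagram.endpointsReceive_of_isPointColoring hf hv⟩

end VirtualTangle
theorem mainTheorem6 (k : ℕ) (v : Fin (2 * k) → ℤ) :
    ((∃ T : VirtualTangle.StringTangle k, T.WithoutLoops ∧ T.EndpointsReceive v) ↔
      VirtualTangle.alternatingSum v ≡ 0 [ZMOD 2 * (VirtualTangle.diffGcdTwo v : ℤ)]) ∧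
    ((∃ T : VirtualTangle.StringTangle k, T.EndpointsReceive v) ↔
      VirtualTangle.alternatingSum v ≡ 0 [ZMOD 2]) := by
  open VirtualTangle in
  refine ⟨⟨fun ⟨T, hT, h⟩ => alternatingSum_modEq_of_withoutLoops hT h, fun h => ?_⟩,
    ⟨fun ⟨T, C, hC, hv⟩ => ?_, fun h => ?_⟩⟩
  · have hc : Closes False v := closes_of_dvd_sum_sub (even_two_mul k) fun e a he =>
      (dvd_sub_right (two_mul_dvd_alternatingSum h he)).1 (two_mul_dvd_alternatingSum_sub he)
    simpa using hc.exists_stringTangle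
  · have hs := hC.isPointColoring.sum_modEq_two
    simp only [hv, Finset.univ_eq_empty, Finset.sum_empty] at hs
    -- With `e = 1` and `a = 0`: Δ and the plain sum agree mod 2.
    have := two_mul_dvd_alternatingSum_sub (v := v) (e := 1) (a := 0) fun _ => one_dvd _
    simp only [sub_zero, mul_one] at this
    exact (Int.modEq_iff_dvd.2 this).symm.trans hs
  · have := two_mul_dvd_alternatingSum_sub (v := v) (e := 1) (a := 0) fun _ => one_dvd _
    simp only [sub_zero, mul_one] at this
    have hc : Closes True v := closes_of_two_dvd_sum (even_two_mul k)
      ((dvd_sub_right (Int.modEq_zero_iff_dvd.1 h)).1 this)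
    simpa using hc.exists_stringTangle
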